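/- \textbf{Setting.} A quantum circuit $\mathfrak C$ is an acyclic oriented bipartite graph with two kinds of nodes. Each s-node $s$ has a dimension $d(s)\in\mathbb N$ and at most one incoming and at most one outgoing arrow. Each o-node has a non-empty ordered list $\Gamma$ of incoming s-nodes and a non-empty ordered list $\Gamma'$ of outgoing s-nodes, and carries one of two operations: a unitary operator $U:\mathbb C^{d(\Gamma)}\to\mathbb C^{d(\Gamma')}$ (written $\Gamma'=U(\Gamma)$), or, when $d(\Gamma)=d(\Gamma')$, a projective measurement whose outcome is a subspace $p$ of $\mathbb C^{d(\Gamma)}=\mathbb C^{d(\Gamma')}$ (written $\Gamma'=\mathrm{Mes}_p(\Gamma)$). Here $d([s_1,\dots,s_n])=\prod_i d(s_i)$. A \emph{slice} is a finite list of distinct s-nodes, none of which is reachable from another along arrows; $\mathrm{Slice}(\mathfrak C)$ is the set of slices and $\Gamma::\Delta$ denotes concatenation. We identify $\mathbb C^{m}\otimes\mathbb C^{n}$ with $\mathbb C^{mn}$ by the lexicographic order on basis vectors. Let $L_n$ be the orthomodular lattice of subspaces of $\mathbb C^n$, with meet $\wedge$ (intersection), join $\vee$ (sum), orthocomplement $\cdot^\perp$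 and greatest element $\top=\mathbb C^n$. For $p,q\in L_n$ let $p\mathbin{\&}q=q\wedge(p\vee q^\perp)$, and for $p\in L_m$, $q\in L_n$ let $p\otimes q\in L_{mn}$ be the span of the vectors $x\otimes y$ with $x\in p$, $y\in q$. The verification statements $\Gamma\Vdash p$ of $\mathfrak C$ (where $\Gamma\in\mathrm{Slice}(\mathfrak C)$ and $p\in L_{d(\Gamma)}$) are those derivable by the following rules, in which all lists are slices of $\mathfrak C$: \begin{itemize} \item (Top) $\Gamma\Vdash\top$; \item (Ord) if $\Gamma\Vdash p$ and $p\le q$, then $\Gamma\Vdash q$; \item (Meet) if $\Gamma\Vdash p$ and $\Gamma\Vdash q$, then $\Gamma\Vdash p\wedge q$; \item (Swap) if $\Gamma::\Delta::\Xi\Vdash p$, then $\Delta::\Gamma::\Xi\Vdash\sigma(p)$, where $\sigma$ is the unitary map $x\otimes y\otimes z\mapsto y\otimes x\otimes z$; \item (Sas) if $\Gamma::\Delta\Vdash p$ and $\Gamma'=\mathrm{Mes}_q(\Gamma)\in\mathfrak C$, then $\Gamma'::\Delta\Vdash p\mathbin{\&}(q\otimes\top)$; \item (Uni) if $\Gamma::\Delta\Vdash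 p$ and $\Gamma'=U(\Gamma)\in\mathfrak C$, then $\Gamma'::\Delta\Vdash(U\otimes\mathrm{Id})(p)$; \item (Tens) if $\Gamma\Vdash p$, then $\Gamma::\Delta\Vdash p\otimes\top$. \end{itemize} For a slice $\Gamma$, the set of all $p\in L_{d(\Gamma)}$ with $\Gamma\Vdash p$ has a least element; it is called the epistemic state of $\mathfrak C$ at $\Gamma$ and denoted $k_{\mathfrak C}(\Gamma)$. \textbf{Proposition.} Let $\Gamma::\Delta\in\mathrm{Slice}(\mathfrak C)$ and let $\Gamma'=\mathrm{Mes}_p(\Gamma)$ be a measurement o-node of $\mathfrak C$. Then $\Gamma'::\Delta\in\mathrm{Slice}(\mathfrak C)$ and $$k_{\mathfrak C}(\Gamma'::\Delta)=k_{\mathfrak C}(\Gamma::\Delta)\mathbin{\&}(p\otimes\top),$$ where $\top$ is the greatest element of $L_{d(\Delta)}$. -/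

import Mathlib

namespace QuantumCircuit

/-- The Hilbert space `ℂⁿ` with its standard inner product. -/
abbrev Hilb (n : ℕ) : Type := EuclideanSpace ℂ (Fin n)

/-- The orthomodular lattice of all subspaces of `ℂⁿ`. -/
abbrev Subsp (n : ℕ) : Type := Submodule ℂ (Hilb n)

/-- The identification of the subspaces of `ℂᵐ` with those of `ℂⁿ` when `m = n`. -/
def transport {m n : ℕ} (h : m = n) (p : Subsp m) : Subsp n := h ▸ p

/-- The Sasaki operator `p & q = q ∧ (p ∨ q^⊥)`. -/
noncomputable def sasaki {n : ℕ} (p q : Subsp n) : Subsp n := q ⊓ (p ⊔ qᗮ)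

/-- The vector `x ⊗ y` in `ℂᵐ ⊗ ℂⁿ = ℂᵐⁿ`, where the pair of indices `(i, j)` is numbered
lexicographically, by `n * i + j`. -/
noncomputable def tensorVec {m n : ℕ} (x : Hilb m) (y : Hilb n) : Hilb (m * n) :=
  WithLp.toLp 2 fun k => x (finProdFinEquiv.symm k).1 * y (finProdFinEquiv.symm k).2

/-- The tensor product `p ⊗ q` of two subspaces. -/
noncomputable def tensor {m n : ℕ} (p : Subsp m) (q : Subsp n) : Subsp (m * n) :=
  Submodule.span ℂ {z | ∃ x ∈ p, ∃ y ∈ q, z = tensorVec x y}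

/-- The linear map `U ⊗ Id` from `ℂᵐ ⊗ ℂᶜ` to `ℂⁿ ⊗ ℂᶜ`. -/
noncomputable def tensorId {m n : ℕ} (U : Hilb m →ₗ[ℂ] Hilb n) (c : ℕ) :
    Hilb (m * c) →ₗ[ℂ] Hilb (n * c) where
  toFun z := WithLp.toLp 2 fun k =>
    U (WithLp.toLp 2 fun i => z (finProdFinEquiv (i, (finProdFinEquiv.symm k).2)))
      (finProdFinEquiv.symm k).1
  map_add' z w := by
    ext k
    have h : ∀ j : Fin c,
        (WithLp.toLp 2 fun i => (z + w) (finProdFinEquiv (i, j)) : Hilb m) =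
          (WithLp.toLp 2 fun i => z (finProdFinEquiv (i, j))) +
            WithLp.toLp 2 fun i => w (finProdFinEquiv (i, j)) := fun j => rfl
    show U (WithLp.toLp 2 fun i => (z + w) (finProdFinEquiv (i, (finProdFinEquiv.symm k).2)))
      (finProdFinEquiv.symm k).1 = _
    rw [h, map_add]
    rfl
  map_smul' a z := by
    ext k
    have h : ∀ j : Fin c,
        (WithLp.toLp 2 fun i => (a • z) (finProdFinEquiv (i, j)) : Hilb m) =
          a • WithLp.toLp 2 fun i => z (finProdFinEquiv (i, j)) := fun j => rfl
    show U (WithLp.toLp 2 fun i => (a • z) (finProdFinEquiv (i, (finProdFinEquiv.symm k).2)))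
      (finProdFinEquiv.symm k).1 = _
    rw [h, map_smul]
    rfl

/-- `U ⊗ Id` maps `x ⊗ y` to `U x ⊗ y`. -/
theorem tensorId_tensorVec {m n c : ℕ} (U : Hilb m →ₗ[ℂ] Hilb n) (x : Hilb m) (y : Hilb c) :
    tensorId U c (tensorVec x y) = tensorVec (U x) y := by
  ext k
  have h : (WithLp.toLp 2 fun i =>
      (tensorVec x y) (finProdFinEquiv (i, (finProdFinEquiv.symm k).2)) : Hilb m) =
        y (finProdFinEquiv.symm k).2 • x := by
    ext i
    simp only [tensorVec, Equiv.symm_apply_apply, PiLp.smul_apply, smul_eq_mul]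
    ring
  show U (WithLp.toLp 2 fun i =>
      (tensorVec x y) (finProdFinEquiv (i, (finProdFinEquiv.symm k).2)))
      (finProdFinEquiv.symm k).1 = U x (finProdFinEquiv.symm k).1 * y (finProdFinEquiv.symm k).2
  rw [h, map_smul, PiLp.smul_apply, smul_eq_mul]
  exact mul_comm _ _

/-- The bijection `(i, j, k) ↦ (j, i, k)` on the indices of a threefold tensor product. -/
def swapIndex (a b c : ℕ) : Fin (a * b * c) ≃ Fin (b * a * c) :=
  finProdFinEquiv.symm.trans
    ((((finProdFinEquiv.symm.trans (Equiv.prodComm (Fin a) (Fin b))).trans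
      finProdFinEquiv).prodCongr (Equiv.refl (Fin c))).trans finProdFinEquiv)

/-- The unitary map from `ℂᵃ ⊗ ℂᵇ ⊗ ℂᶜ` to `ℂᵇ ⊗ ℂᵃ ⊗ ℂᶜ` that sends `e_i ⊗ f_j ⊗ g_k` to
`f_j ⊗ e_i ⊗ g_k`. -/
noncomputable def swapMap (a b c : ℕ) : Hilb (a * b * c) ≃ₗᵢ[ℂ] Hilb (b * a * c) :=
  LinearIsometryEquiv.piLpCongrLeft 2 ℂ ℂ (swapIndex a b c)

/-- `swapMap` maps `x ⊗ y ⊗ z` to `y ⊗ x ⊗ z`. -/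
theorem swapMap_tensorVec {a b c : ℕ} (x : Hilb a) (y : Hilb b) (z : Hilb c) :
    swapMap a b c (tensorVec (tensorVec x y) z) = tensorVec (tensorVec y x) z := by
  ext k
  obtain ⟨⟨u, l⟩, rfl⟩ := finProdFinEquiv.surjective k
  obtain ⟨⟨j, i⟩, rfl⟩ := finProdFinEquiv.surjective u
  have hs : (swapIndex a b c).symm (finProdFinEquiv (finProdFinEquiv (j, i), l)) =
      finProdFinEquiv (finProdFinEquiv (i, j), l) := by
    rw [Equiv.symm_apply_eq]
    simp only [swapIndex, Equiv.trans_apply, Equiv.symm_apply_apply, Equiv.prodCongr_apply,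
      Prod.map_apply, Equiv.prodComm_apply, Prod.swap_prod_mk, Equiv.refl_apply]
  show tensorVec (tensorVec x y) z ((swapIndex a b c).symm _) = _
  rw [hs]
  simp only [tensorVec, Equiv.symm_apply_apply]
  ring

/-- The operation carried by an o-node whose incoming s-nodes have total dimension `m` and whose
outgoing ones have total dimension `n`: a unitary operator from `ℂᵐ` to `ℂⁿ`, or (if `m = n`) a
projective measurement with outcome the subspace `p`, that is, the orthogonal projection on `p`. -/
inductive Operation (m n : ℕ) : Type
  | unitary (U : Hilb m ≃ₗᵢ[ℂ] Hilb n) : Operation m n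
  | measurement (h : m = n) (p : Subsp m) : Operation m n

/-- The arrows of the bipartite graph on `S` (s-nodes) and `O` (o-nodes) in which the o-node `o`
has the incoming s-nodes `inp o` and the outgoing s-nodes `out o`. -/
def Arrow {S O : Type*} (inp out : O → List S) : S ⊕ O → S ⊕ O → Prop
  | .inl s, .inr o => s ∈ inp o
  | .inr o, .inl s => s ∈ out o
  | _, _ => False

end QuantumCircuit

open QuantumCircuit

/-- A quantum circuit with s-nodes `S` and o-nodes `O`. -/
structure QuantumCircuit (S O : Type*) where
  /-- The dimension of an s-node. -/
  dim : S → ℕ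
  /-- The ordered list of incoming s-nodes of an o-node. -/
  inp : O → List S
  /-- The ordered list of outgoing s-nodes of an o-node. -/
  out : O → List S
  inp_ne_nil : ∀ o, inp o ≠ []
  out_ne_nil : ∀ o, out o ≠ []
  /-- An s-node has at most one outgoing arrow. -/
  inp_nodup : ∀ o, (inp o).Nodup
  inp_unique : ∀ s o o', s ∈ inp o → s ∈ inp o' → o = o'
  /-- An s-node has at most one incoming arrow. -/
  out_nodup : ∀ o, (out o).Nodup
  out_unique : ∀ s o o', s ∈ out o → s ∈ out o' → o = o'
  acyclic : ∀ x, ¬ Relation.TransGen (Arrow inp out) x x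
  /-- The operator of an o-node. -/
  op : ∀ o, Operation ((inp o).map dim).prod ((out o).map dim).prod

namespace QuantumCircuit

variable {S O : Type*}

/-- There is a path with at least one arrow from the s-node `s` to the s-node `t`. -/
def Precedes (C : QuantumCircuit S O) (s t : S) : Prop :=
  Relation.TransGen (Arrow C.inp C.out) (.inl s) (.inl t)

/-- A slice: an ordered set of mutually uncomparable s-nodes. -/
def IsSlice (C : QuantumCircuit S O) (Γ : List S) : Prop :=
  Γ.Nodup ∧ ∀ s ∈ Γ, ∀ t ∈ Γ, ¬ C.Precedes s t

/-- The dimension of a list of s-nodes. -/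
def dimOf (C : QuantumCircuit S O) (Γ : List S) : ℕ := (Γ.map C.dim).prod

theorem dimOf_append (C : QuantumCircuit S O) (Γ Δ : List S) :
    C.dimOf (Γ ++ Δ) = C.dimOf Γ * C.dimOf Δ := by
  simp [dimOf]

theorem dimOf_append₃ (C : QuantumCircuit S O) (Γ Δ Ξ : List S) :
    C.dimOf (Γ ++ Δ ++ Ξ) = C.dimOf Γ * C.dimOf Δ * C.dimOf Ξ := by
  rw [dimOf_append, dimOf_append]

theorem dimOf_append_congr (C : QuantumCircuit S O) {Γ Γ' : List S}
    (h : C.dimOf Γ = C.dimOf Γ') (Δ : List S) :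
    C.dimOf (Γ ++ Δ) = C.dimOf (Γ' ++ Δ) := by
  rw [dimOf_append, dimOf_append, h]

/-- `p ⊗ ⊤`, as a subspace of the space of the concatenation `Γ :: Δ`. -/
noncomputable def tensorTop (C : QuantumCircuit S O) (Γ Δ : List S) (p : Subsp (C.dimOf Γ)) :
    Subsp (C.dimOf (Γ ++ Δ)) :=
  transport (C.dimOf_append Γ Δ).symm (tensor p ⊤)

/-- The action on subspaces of the block swap from `Γ :: Δ :: Ξ` to `Δ :: Γ :: Ξ`. -/
noncomputable def swapSubsp (C : QuantumCircuit S O) (Γ Δ Ξ : List S)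
    (p : Subsp (C.dimOf (Γ ++ Δ ++ Ξ))) : Subsp (C.dimOf (Δ ++ Γ ++ Ξ)) :=
  transport (C.dimOf_append₃ Δ Γ Ξ).symm
    ((transport (C.dimOf_append₃ Γ Δ Ξ) p).map
      (swapMap (C.dimOf Γ) (C.dimOf Δ) (C.dimOf Ξ)).toLinearEquiv.toLinearMap)

/-- The image `(U ⊗ Id)(p)` of a subspace `p` of the space of `Γ :: Δ`, as a subspace of the space
of `Γ' :: Δ`. -/
noncomputable def applySubsp (C : QuantumCircuit S O) {Γ Γ' : List S}
    (U : Hilb (C.dimOf Γ) ≃ₗᵢ[ℂ] Hilb (C.dimOf Γ')) (Δ : List S)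
    (p : Subsp (C.dimOf (Γ ++ Δ))) : Subsp (C.dimOf (Γ' ++ Δ)) :=
  transport (C.dimOf_append Γ' Δ).symm
    ((transport (C.dimOf_append Γ Δ) p).map
      (tensorId U.toLinearEquiv.toLinearMap (C.dimOf Δ)))

/-- `C.IsUnitaryNode o U` says that `out o = U(inp o)` is a unitary o-node of `C`. -/
def IsUnitaryNode (C : QuantumCircuit S O) (o : O)
    (U : Hilb (C.dimOf (C.inp o)) ≃ₗᵢ[ℂ] Hilb (C.dimOf (C.out o))) : Prop :=
  C.op o = Operation.unitary U

/-- `C.IsMeasurementNode o h p` says that `out o = Mes_p(inp o)` is a measurement o-node of `C`. -/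
def IsMeasurementNode (C : QuantumCircuit S O) (o : O)
    (h : C.dimOf (C.inp o) = C.dimOf (C.out o)) (p : Subsp (C.dimOf (C.inp o))) : Prop :=
  C.op o = Operation.measurement h p

/-- Provability of verification statements: `C.Verifies Γ p` says that the circuit `C` verifies
`p` at the slice `Γ`. -/
inductive Verifies (C : QuantumCircuit S O) : (Γ : List S) → Subsp (C.dimOf Γ) → Prop
  | top {Γ : List S} (hΓ : C.IsSlice Γ) : Verifies C Γ ⊤
  | ord {Γ : List S} {p q : Subsp (C.dimOf Γ)} (hp : Verifies C Γ p) (hpq : p ≤ q) :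
      Verifies C Γ q
  | meet {Γ : List S} {p q : Subsp (C.dimOf Γ)} (hp : Verifies C Γ p) (hq : Verifies C Γ q) :
      Verifies C Γ (p ⊓ q)
  | swap {Γ Δ Ξ : List S} {p : Subsp (C.dimOf (Γ ++ Δ ++ Ξ))}
      (hp : Verifies C (Γ ++ Δ ++ Ξ) p) :
      Verifies C (Δ ++ Γ ++ Ξ) (C.swapSubsp Γ Δ Ξ p)
  | sas {o : O} {Δ : List S} {h : C.dimOf (C.inp o) = C.dimOf (C.out o)}
      {p : Subsp (C.dimOf (C.inp o ++ Δ))} {q : Subsp (C.dimOf (C.inp o))}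
      (hp : Verifies C (C.inp o ++ Δ) p) (ho : C.IsMeasurementNode o h q) :
      Verifies C (C.out o ++ Δ)
        (transport (C.dimOf_append_congr h Δ) (sasaki p (C.tensorTop (C.inp o) Δ q)))
  | uni {o : O} {Δ : List S} {U : Hilb (C.dimOf (C.inp o)) ≃ₗᵢ[ℂ] Hilb (C.dimOf (C.out o))}
      {p : Subsp (C.dimOf (C.inp o ++ Δ))}
      (hp : Verifies C (C.inp o ++ Δ) p) (ho : C.IsUnitaryNode o U) :
      Verifies C (C.out o ++ Δ) (C.applySubsp U Δ p)
  | tens {Γ Δ : List S} {p : Subsp (C.dimOf Γ)} (hp : Verifies C Γ p)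
      (hΓΔ : C.IsSlice (Γ ++ Δ)) :
      Verifies C (Γ ++ Δ) (C.tensorTop Γ Δ p)

/-- The epistemic state `k_C(Γ)`: the least subspace that `C` verifies at `Γ`. -/
noncomputable def epistemicState (C : QuantumCircuit S O) (Γ : List S) : Subsp (C.dimOf Γ) :=
  sInf {p | C.Verifies Γ p}

/-- At a slice, the epistemic state is indeed the least verified subspace. -/
theorem verifies_iff (C : QuantumCircuit S O) {Γ : List S} (hΓ : C.IsSlice Γ)
    (p : Subsp (C.dimOf Γ)) : C.Verifies Γ p ↔ C.epistemicState Γ ≤ p := by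
  refine ⟨fun hp => sInf_le hp, fun hp => ?_⟩
  obtain ⟨e, he, hmin⟩ := (IsWellFounded.wf (r := ((· < ·) : Subsp (C.dimOf Γ) → _ → Prop))).has_min
    {p | C.Verifies Γ p} ⟨⊤, Verifies.top hΓ⟩
  refine Verifies.ord he (le_trans (le_sInf fun q hq => ?_) hp)
  have h1 : ¬ e ⊓ q < e := hmin _ (Verifies.meet he hq)
  have h2 : e ⊓ q = e := by
    by_contra hne
    exact h1 (lt_of_le_of_ne inf_le_left hne)
  exact inf_eq_left.mp h2

/-- Replacing the incoming nodes of an o-node by its outgoing nodes turns slices into slices. -/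
theorem isSlice_out (C : QuantumCircuit S O) {o : O} {Δ : List S}
    (h : C.IsSlice (C.inp o ++ Δ)) : C.IsSlice (C.out o ++ Δ) := by
  obtain ⟨hnd, hnp⟩ := h
  obtain ⟨g, hg⟩ := List.exists_mem_of_ne_nil _ (C.inp_ne_nil o)
  have inp_out : ∀ r ∈ C.inp o, ∀ t ∈ C.out o, C.Precedes r t := fun r hr t ht =>
    Relation.TransGen.tail (b := .inr o)
      (Relation.TransGen.single (show Arrow C.inp C.out (.inl r) (.inr o) from hr))
      (show Arrow C.inp C.out (.inr o) (.inl t) from ht)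
  -- A path to an outgoing node of `o` passes through an incoming one.
  have back : ∀ s, ∀ t ∈ C.out o, C.Precedes s t →
      ∃ r ∈ C.inp o, s = r ∨ C.Precedes s r := by
    intro s t ht hst
    obtain ⟨y, hy, hyt⟩ := Relation.TransGen.tail'_iff.mp hst
    rcases y with r | o'
    · exact hyt.elim
    · have ho : o' = o := C.out_unique t o' o hyt ht
      subst ho
      rcases Relation.ReflTransGen.cases_tail hy with h | ⟨z, hz, hzo⟩
      · cases h
      · rcases z with r | o''
        · refine ⟨r, hzo, ?_⟩
          rcases Relation.reflTransGen_iff_eq_or_transGen.mp hz with h | h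
          · left
            exact (Sum.inl.inj h).symm
          · exact Or.inr h
        · exact hzo.elim
  have out_out : ∀ s ∈ C.out o, ∀ t ∈ C.out o, ¬ C.Precedes s t := by
    intro s hs t ht hst
    obtain ⟨r, hr, hsr⟩ := back s t ht hst
    have hrs : C.Precedes r s := inp_out r hr s hs
    rcases hsr with rfl | hsr
    · exact C.acyclic _ hrs
    · exact C.acyclic _ (Relation.TransGen.trans hrs hsr)
  have hgm : g ∈ C.inp o ++ Δ := List.mem_append_left _ hg
  refine ⟨List.nodup_append.mpr ⟨C.out_nodup o, (List.nodup_append.mp hnd).2.1, ?_⟩, ?_⟩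
  · rintro t ht _ hd rfl
    exact hnp g hgm t (List.mem_append_right _ hd) (inp_out g hg t ht)
  · intro s hs t ht hst
    rcases List.mem_append.mp hs with hs | hs <;> rcases List.mem_append.mp ht with ht | ht
    · exact out_out s hs t ht hst
    · exact hnp g hgm t (List.mem_append_right _ ht)
        (Relation.TransGen.trans (inp_out g hg s hs) hst)
    · obtain ⟨r, hr, hsr⟩ := back s t ht hst
      rcases hsr with rfl | hsr
      · exact (List.nodup_append.mp hnd).2.2 s hr s hs rfl
      · exact hnp s (List.mem_append_right _ hs) r (List.mem_append_left _ hr) hsr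
    · exact hnp s (List.mem_append_right _ hs) t (List.mem_append_right _ ht) hst

end QuantumCircuit

namespace QuantumCircuit

/-! The inequality `≤` is the rule (Sas) applied to the epistemic state before the measurement. For
`≥`, every `q` verified at `Γ' :: Δ` must be shown to contain the image of that state, however `q`
was derived.

The Sasaki operator with `q ⊗ ⊤` is the image under the projection on `q` tensored with the identity
(`sasaki_tensor_top`). Hence measurements and unitaries alike are linear maps `M ⊗ Id`, and the
theorem is a case of `epistemicState_out`, valid for every o-node. To compare different slices in
one space, vectors are replaced by functions `f` on assignments of basis indices to all s-nodes:
`Holds Γ p f` places `f` in `p ⊗ ⊤`, and `evolve M` applies an operator to such functions.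

The core is `Verifies.holds_evolve`, by induction on the derivation: if `f` is known before `o`,
then whatever is verified after `o` holds of the evolved `f`. If the last rule uses `o` itself, this
is immediate. If it uses another node `o'`, the two nodes act on disjoint s-nodes: `f` is locally
the image under `o'` of a function known before both (`exists_evolve_eq`), and the two evolutions
commute (`evolve_comm`). If (Tens) has added some of the outgoing nodes of `o`, the premise sees
only a proper part of them, and `Verifies.holds_of_known_rest` shows that such a part carries no
information. -/

/-! ### Tensor products by columns; the Sasaki operator as a projection -/

/-- The `j`-th column of a vector of `ℂᵐ ⊗ ℂⁿ`. -/
noncomputable def col {m n : ℕ} (z : Hilb (m * n)) (j : Fin n) : Hilb m :=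
  WithLp.toLp 2 fun i => z (finProdFinEquiv (i, j))

theorem col_apply {m n : ℕ} (z : Hilb (m * n)) (j : Fin n) (i : Fin m) :
    col z j i = z (finProdFinEquiv (i, j)) := rfl

theorem hilb_ext_col {m n : ℕ} {z w : Hilb (m * n)} (h : ∀ j, col z j = col w j) : z = w := by
  ext k
  obtain ⟨⟨i, j⟩, rfl⟩ := finProdFinEquiv.surjective k
  rw [← col_apply, h, col_apply]

theorem col_tensorId {m n c : ℕ} (U : Hilb m →ₗ[ℂ] Hilb n) (z : Hilb (m * c)) (j : Fin c) :
    col (tensorId U c z) j = U (col z j) := by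
  ext i
  rw [col_apply]
  show U (WithLp.toLp 2 fun i' => z (finProdFinEquiv
    (i', (finProdFinEquiv.symm (finProdFinEquiv (i, j))).2)))
      (finProdFinEquiv.symm (finProdFinEquiv (i, j))).1 = _
  rw [Equiv.symm_apply_apply]
  rfl

theorem tensorVec_apply {m n : ℕ} (x : Hilb m) (y : Hilb n) (i : Fin m) (j : Fin n) :
    tensorVec x y (finProdFinEquiv (i, j)) = x i * y j := by
  simp only [tensorVec, Equiv.symm_apply_apply]

theorem col_tensorVec {m n : ℕ} (x : Hilb m) (y : Hilb n) (j : Fin n) :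
    col (tensorVec x y) j = y j • x := by
  ext i
  rw [col_apply, tensorVec_apply, PiLp.smul_apply, smul_eq_mul, mul_comm]

theorem mem_tensor_top {m n : ℕ} {p : Subsp m} {z : Hilb (m * n)} :
    z ∈ tensor p (⊤ : Subsp n) ↔ ∀ j, col z j ∈ p := by
  constructor
  · intro hz j
    induction hz using Submodule.span_induction with
    | mem z hz =>
      obtain ⟨x, hx, y, -, rfl⟩ := hz
      rw [col_tensorVec]
      exact p.smul_mem _ hx
    | zero => exact p.zero_mem
    | add z w _ _ hz hw => exact p.add_mem hz hw
    | smul a z _ hz => exact p.smul_mem a hz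
  · intro h
    have hz : z = ∑ j, tensorVec (col z j) (EuclideanSpace.single j (1 : ℂ)) := by
      ext k
      obtain ⟨⟨i, j⟩, rfl⟩ := finProdFinEquiv.surjective k
      rw [WithLp.ofLp_sum, Finset.sum_apply, Finset.sum_eq_single j]
      · simp [tensorVec_apply, col_apply]
      · intro b _ hb
        simp [tensorVec_apply, hb.symm]
      · simp
    rw [hz]
    exact Submodule.sum_mem _ fun j _ => Submodule.subset_span ⟨_, h j, _, trivial, rfl⟩

theorem inner_eq_sum_col {m n : ℕ} (z w : Hilb (m * n)) :
    inner ℂ z w = ∑ j, inner ℂ (col z j) (col w j) := by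
  simp only [PiLp.inner_apply]
  rw [← finProdFinEquiv.sum_comp, Fintype.sum_prod_type_right]
  rfl

/-- A vector and its projection on `q` differ by an element of `qᗮ`, so membership in `p ⊔ qᗮ` only
matters modulo `qᗮ`. -/
theorem mem_sasaki {n : ℕ} {p q : Subsp n} {z : Hilb n} :
    z ∈ sasaki p q ↔ ∃ w ∈ p, q.starProjection w = z := by
  constructor
  · rintro ⟨hq, hpq⟩
    obtain ⟨x, hx, y, hy, rfl⟩ := Submodule.mem_sup.mp hpq
    refine ⟨x, hx, Submodule.eq_starProjection_of_mem_orthogonal hq ?_⟩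
    rw [sub_add_cancel_left]
    exact neg_mem hy
  · rintro ⟨w, hw, rfl⟩
    refine ⟨Submodule.starProjection_apply_mem _ _, ?_⟩
    have := neg_mem (Submodule.sub_starProjection_mem_orthogonal (K := q) w)
    rw [show q.starProjection w = w + -(w - q.starProjection w) by abel]
    exact Submodule.add_mem_sup hw this

theorem starProjection_tensor_top {m n : ℕ} (q : Subsp m) (z : Hilb (m * n)) :
    (tensor q (⊤ : Subsp n)).starProjection z =
      tensorId q.starProjection.toLinearMap n z := by
  refine Submodule.eq_starProjection_of_mem_orthogonal ?_ ?_
  · rw [mem_tensor_top]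
    intro j
    rw [col_tensorId]
    exact Submodule.starProjection_apply_mem _ _
  · rw [Submodule.mem_orthogonal]
    intro w hw
    rw [inner_eq_sum_col]
    refine Finset.sum_eq_zero fun j _ => ?_
    have h : col (z - tensorId q.starProjection.toLinearMap n z) j =
        col z j - q.starProjection (col z j) := by
      have := col_tensorId q.starProjection.toLinearMap z j
      rw [ContinuousLinearMap.coe_coe] at this
      rw [← this]
      rfl
    rw [h]
    exact Submodule.inner_right_of_mem_orthogonal (mem_tensor_top.mp hw j)
      (Submodule.sub_starProjection_mem_orthogonal _)

/-- The Sasaki operator with `q ⊗ ⊤` applies the projection on `q` to the first factor. -/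
theorem sasaki_tensor_top {m n : ℕ} (p : Subsp (m * n)) (q : Subsp m) :
    sasaki p (tensor q ⊤) = p.map (tensorId q.starProjection.toLinearMap n) := by
  ext z
  simp only [mem_sasaki, starProjection_tensor_top, Submodule.mem_map]

/-- The identification of `ℂᵐ` with `ℂⁿ` when `m = n`. -/
noncomputable def castLin {m n : ℕ} (h : m = n) : Hilb m →ₗ[ℂ] Hilb n where
  toFun z := WithLp.toLp 2 fun i => z (Fin.cast h.symm i)
  map_add' _ _ := rfl
  map_smul' _ _ := rfl

theorem mem_transport {m n : ℕ} (h : m = n) {p : Subsp m} {z : Hilb n} :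
    z ∈ transport h p ↔ castLin h.symm z ∈ p := by
  subst h
  rfl

theorem castLin_castLin {m n : ℕ} (h : m = n) (z : Hilb m) :
    castLin h.symm (castLin h z) = z := by
  subst h
  rfl

/-- The dimensions `a` and `b` are variables so that every transport disappears by substitution. -/
theorem transport_sasaki {m n c a b : ℕ} (h : m = n) (ha : a = m * c) (hb : b = n * c)
    (hab : a = b) (p : Subsp a) (q : Subsp m) :
    transport hab (sasaki p (transport ha.symm (tensor q ⊤))) =
      transport hb.symm ((transport ha p).map
        (tensorId (castLin h ∘ₗ q.starProjection.toLinearMap) c)) := by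
  subst h ha hb
  exact sasaki_tensor_top p q

/-- The linear map performed by an operation. -/
noncomputable def opMap {m n : ℕ} : Operation m n → (Hilb m →ₗ[ℂ] Hilb n)
  | .unitary U => U.toLinearEquiv.toLinearMap
  | .measurement h p => castLin h ∘ₗ p.starProjection.toLinearMap

theorem Operation.dim_eq {m n : ℕ} : Operation m n → m = n
  | .unitary U => by simpa using U.toLinearEquiv.finrank_eq
  | .measurement h _ => h

/-- The `k`-th coordinate of the image of the `l`-th basis vector (`0` if there is none). -/
noncomputable def coef {m n : ℕ} (M : Hilb m →ₗ[ℂ] Hilb n) (k : ℕ) (l : Fin m) : ℂ :=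
  if h : k < n then M (EuclideanSpace.single l 1) ⟨k, h⟩ else 0

theorem apply_eq_sum_coef {m n : ℕ} (M : Hilb m →ₗ[ℂ] Hilb n) (v : Hilb m) (k : Fin n) :
    M v k = ∑ l, coef M k l * v l := by
  have hv : v = ∑ l, v l • EuclideanSpace.single l (1 : ℂ) := by
    ext i
    rw [WithLp.ofLp_sum, Finset.sum_apply]
    simp
  conv_lhs => rw [hv, map_sum, WithLp.ofLp_sum, Finset.sum_apply]
  simp [coef, mul_comm]

/-! ### Assignments of basis indices to s-nodes and their mixed-radix numbering -/

variable {S O : Type*}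
/-- The number of the basis vector of `Γ` that is selected by the values `e`. -/
def enc (C : QuantumCircuit S O) : List S → (S → ℕ) → ℕ
  | [], _ => 0
  | s :: Γ, e => C.dimOf Γ * e s + C.enc Γ e

open Classical in
/-- The values on the nodes of `Γ` that select the basis vector with number `k`. -/
noncomputable def dig (C : QuantumCircuit S O) : List S → ℕ → S → ℕ
  | [], _ => fun _ => 0
  | t :: Γ, k => fun s => if s = t then k / C.dimOf Γ else C.dig Γ (k % C.dimOf Γ) s

open Classical in
/-- The values `c`, replaced on `Γ` by those that select the basis vector with number `k`. -/
noncomputable def ov (C : QuantumCircuit S O) (Γ : List S) (c : S → ℕ) (k : ℕ) (s : S) : ℕ :=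
  if s ∈ Γ then C.dig Γ k s else c s

open Classical in
/-- The values `e`, replaced on `Γ` by those of `c`. -/
noncomputable def replaceOn (Γ : List S) (e c : S → ℕ) (s : S) : ℕ :=
  if s ∈ Γ then c s else e s

/-- The values `c` are in range at the nodes of `Γ`. -/
def ValidOn (C : QuantumCircuit S O) (Γ : List S) (c : S → ℕ) : Prop :=
  ∀ s ∈ Γ, c s < C.dim s

/-- The values `c` are in range at all nodes of positive dimension. -/
def Valid (C : QuantumCircuit S O) (c : S → ℕ) : Prop :=
  ∀ s, c s < C.dim s ∨ C.dim s = 0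

theorem dimOf_cons (C : QuantumCircuit S O) (s : S) (Γ : List S) :
    C.dimOf (s :: Γ) = C.dim s * C.dimOf Γ := by simp [dimOf]

theorem dimOf_perm (C : QuantumCircuit S O) {Γ Γ' : List S} (h : Γ.Perm Γ') :
    C.dimOf Γ = C.dimOf Γ' := (h.map _).prod_eq

theorem dim_ne_zero (C : QuantumCircuit S O) {Γ : List S} (h : C.dimOf Γ ≠ 0) {s : S}
    (hs : s ∈ Γ) : C.dim s ≠ 0 := fun h0 =>
  h (List.prod_eq_zero (List.mem_map.mpr ⟨s, hs, h0⟩))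

theorem Valid.validOn {C : QuantumCircuit S O} {c : S → ℕ} (hc : C.Valid c) {Γ : List S}
    (h : C.dimOf Γ ≠ 0) : C.ValidOn Γ c := fun s hs =>
  (hc s).resolve_right (C.dim_ne_zero h hs)

theorem enc_congr (C : QuantumCircuit S O) {Γ : List S} {e e' : S → ℕ}
    (h : ∀ s ∈ Γ, e s = e' s) : C.enc Γ e = C.enc Γ e' := by
  induction Γ with
  | nil => rfl
  | cons s Γ ih =>
    simp only [enc]
    rw [h s (by simp), ih fun t ht => h t (by simp [ht])]

theorem enc_lt (C : QuantumCircuit S O) {Γ : List S} {e : S → ℕ} (h : C.ValidOn Γ e) :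
    C.enc Γ e < C.dimOf Γ := by
  induction Γ with
  | nil => simp [enc, dimOf]
  | cons s Γ ih =>
    rw [dimOf_cons]
    simp only [enc]
    have h1 := ih fun t ht => h t (by simp [ht])
    have h2 : e s + 1 ≤ C.dim s := h s (by simp)
    nlinarith [Nat.mul_le_mul_right (C.dimOf Γ) h2]

theorem enc_append (C : QuantumCircuit S O) (Γ Δ : List S) (e : S → ℕ) :
    C.enc (Γ ++ Δ) e = C.enc Δ e + C.dimOf Δ * C.enc Γ e := by
  induction Γ with
  | nil => simp [enc]
  | cons s Γ ih =>
    simp only [List.cons_append, enc]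
    rw [ih, dimOf_append]
    ring

theorem dig_lt (C : QuantumCircuit S O) {Γ : List S} {k : ℕ} (hk : k < C.dimOf Γ) :
    C.ValidOn Γ (C.dig Γ k) := by
  induction Γ generalizing k with
  | nil => intro s hs; simp at hs
  | cons t Γ ih =>
    intro s hs
    rw [dimOf_cons] at hk
    have h0 : 0 < C.dimOf Γ := Nat.pos_of_ne_zero fun h => by simp [h] at hk
    simp only [dig]
    split_ifs with hst
    · subst hst
      exact (Nat.div_lt_iff_lt_mul h0).mpr hk
    · exact ih (Nat.mod_lt _ h0) s ((List.mem_cons.mp hs).resolve_left hst)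

theorem enc_dig (C : QuantumCircuit S O) {Γ : List S} (hΓ : Γ.Nodup) {k : ℕ}
    (hk : k < C.dimOf Γ) : C.enc Γ (C.dig Γ k) = k := by
  induction Γ generalizing k with
  | nil => simp [dimOf] at hk; simp [enc, hk]
  | cons t Γ ih =>
    rw [dimOf_cons] at hk
    have h0 : 0 < C.dimOf Γ := Nat.pos_of_ne_zero fun h => by simp [h] at hk
    obtain ⟨ht, hΓ⟩ := List.nodup_cons.mp hΓ
    have h1 : C.enc Γ (C.dig (t :: Γ) k) = C.enc Γ (C.dig Γ (k % C.dimOf Γ)) := by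
      refine C.enc_congr fun s hs => ?_
      have : s ≠ t := fun h => ht (h ▸ hs)
      simp [dig, this]
    simp only [enc]
    rw [h1, ih hΓ (Nat.mod_lt _ h0)]
    simp only [dig, if_true]
    exact Nat.div_add_mod k _

theorem dig_enc (C : QuantumCircuit S O) {Γ : List S} {e : S → ℕ} (h : C.ValidOn Γ e) :
    ∀ s ∈ Γ, C.dig Γ (C.enc Γ e) s = e s := by
  induction Γ with
  | nil => simp
  | cons t Γ ih =>
    intro s hs
    have hv : C.ValidOn Γ e := fun t ht => h t (by simp [ht])
    have hlt := C.enc_lt hv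
    have h0 : 0 < C.dimOf Γ := by omega
    simp only [dig, enc]
    split_ifs with hst
    · subst hst
      rw [Nat.mul_add_div h0, Nat.div_eq_of_lt hlt, add_zero]
    · rw [Nat.mul_add_mod, Nat.mod_eq_of_lt hlt]
      exact ih hv s ((List.mem_cons.mp hs).resolve_left hst)

theorem ov_of_notMem (C : QuantumCircuit S O) {Γ : List S} {c : S → ℕ} {k : ℕ} {s : S}
    (hs : s ∉ Γ) : C.ov Γ c k s = c s := if_neg hs

theorem ov_of_mem (C : QuantumCircuit S O) {Γ : List S} {c : S → ℕ} {k : ℕ} {s : S}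
    (hs : s ∈ Γ) : C.ov Γ c k s = C.dig Γ k s := if_pos hs

theorem ov_congr (C : QuantumCircuit S O) {Γ : List S} {c c' : S → ℕ} (k : ℕ)
    (h : ∀ s, s ∉ Γ → c s = c' s) : C.ov Γ c k = C.ov Γ c' k := by
  funext s
  by_cases hs : s ∈ Γ
  · rw [ov_of_mem _ hs, ov_of_mem _ hs]
  · rw [ov_of_notMem _ hs, ov_of_notMem _ hs, h s hs]

theorem validOn_ov (C : QuantumCircuit S O) (Γ : List S) (c : S → ℕ) {k : ℕ}
    (hk : k < C.dimOf Γ) : C.ValidOn Γ (C.ov Γ c k) := fun s hs => by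
  rw [ov_of_mem _ hs]
  exact C.dig_lt hk s hs

theorem Valid.ov {C : QuantumCircuit S O} {c : S → ℕ} (hc : C.Valid c) (Γ : List S) {k : ℕ}
    (hk : k < C.dimOf Γ) : C.Valid (C.ov Γ c k) := fun s => by
  by_cases hs : s ∈ Γ
  · exact Or.inl (C.validOn_ov Γ c hk s hs)
  · rw [ov_of_notMem _ hs]
    exact hc s

theorem Valid.replaceOn {C : QuantumCircuit S O} {e c : S → ℕ} (he : C.Valid e)
    (hc : C.Valid c) (Γ : List S) : C.Valid (replaceOn Γ e c) := fun s => by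
  unfold QuantumCircuit.replaceOn
  split_ifs
  exacts [hc s, he s]

theorem valid_zero (C : QuantumCircuit S O) : C.Valid 0 := fun s =>
  (Nat.eq_zero_or_pos (C.dim s)).symm

theorem enc_ov (C : QuantumCircuit S O) {Γ : List S} (hΓ : Γ.Nodup) (c : S → ℕ) {k : ℕ}
    (hk : k < C.dimOf Γ) : C.enc Γ (C.ov Γ c k) = k := by
  rw [← C.enc_dig hΓ hk]
  refine C.enc_congr fun s hs => ?_
  rw [ov_of_mem _ hs, C.enc_dig hΓ hk]

theorem enc_ov_of_disjoint (C : QuantumCircuit S O) {Γ Δ : List S} (h : Γ.Disjoint Δ)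
    (c : S → ℕ) (k : ℕ) : C.enc Γ (C.ov Δ c k) = C.enc Γ c :=
  C.enc_congr fun _ hs => ov_of_notMem _ (h hs)

theorem ov_enc (C : QuantumCircuit S O) {Γ : List S} {c e : S → ℕ} (h : C.ValidOn Γ e)
    (hce : ∀ s, s ∉ Γ → c s = e s) : C.ov Γ c (C.enc Γ e) = e := by
  funext s
  by_cases hs : s ∈ Γ
  · rw [ov_of_mem _ hs, C.dig_enc h s hs]
  · rw [ov_of_notMem _ hs, hce s hs]

theorem ov_append (C : QuantumCircuit S O) {Γ Δ : List S} (h : (Γ ++ Δ).Nodup) (c : S → ℕ)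
    {i j : ℕ} (hi : i < C.dimOf Γ) (hj : j < C.dimOf Δ) :
    C.ov (Γ ++ Δ) c (j + C.dimOf Δ * i) = C.ov Γ (C.ov Δ c j) i := by
  obtain ⟨hΓ, hΔ, -⟩ := List.nodup_append.mp h
  have hd := List.disjoint_of_nodup_append h
  have he : C.enc (Γ ++ Δ) (C.ov Γ (C.ov Δ c j) i) = j + C.dimOf Δ * i := by
    rw [enc_append, C.enc_ov hΓ _ hi, C.enc_ov_of_disjoint hd.symm, C.enc_ov hΔ _ hj]
  rw [← he]
  refine C.ov_enc ?_ ?_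
  · intro s hs
    by_cases h1 : s ∈ Γ
    · exact C.validOn_ov _ _ hi s h1
    · rw [ov_of_notMem _ h1]
      exact C.validOn_ov _ _ hj s ((List.mem_append.mp hs).resolve_left h1)
  · intro s hs
    rw [List.mem_append, not_or] at hs
    rw [ov_of_notMem _ hs.1, ov_of_notMem _ hs.2]

theorem ov_comm (C : QuantumCircuit S O) {Γ Δ : List S} (h : Γ.Disjoint Δ) (c : S → ℕ)
    (i j : ℕ) : C.ov Γ (C.ov Δ c j) i = C.ov Δ (C.ov Γ c i) j := by
  funext s
  by_cases h1 : s ∈ Γ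
  · rw [ov_of_mem _ h1, ov_of_notMem _ (h h1), ov_of_mem _ h1]
  · rw [ov_of_notMem _ h1]
    by_cases h2 : s ∈ Δ
    · rw [ov_of_mem _ h2, ov_of_mem _ h2]
    · rw [ov_of_notMem _ h2, ov_of_notMem _ h2, ov_of_notMem _ h1]

theorem replaceOn_of_mem {Γ : List S} {e c : S → ℕ} {s : S} (hs : s ∈ Γ) :
    replaceOn Γ e c s = c s := if_pos hs

theorem replaceOn_of_notMem {Γ : List S} {e c : S → ℕ} {s : S} (hs : s ∉ Γ) :
    replaceOn Γ e c s = e s := if_neg hs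

theorem replaceOn_ov (C : QuantumCircuit S O) {Γ Δ : List S} (h : Γ.Disjoint Δ) (c d : S → ℕ)
    (j : ℕ) : replaceOn Γ (C.ov Δ c j) d = C.ov Δ (replaceOn Γ c d) j := by
  funext s
  by_cases h1 : s ∈ Γ
  · rw [replaceOn_of_mem h1, ov_of_notMem _ (h h1), replaceOn_of_mem h1]
  · rw [replaceOn_of_notMem h1]
    by_cases h2 : s ∈ Δ
    · rw [ov_of_mem _ h2, ov_of_mem _ h2]
    · rw [ov_of_notMem _ h2, ov_of_notMem _ h2, replaceOn_of_notMem h1]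

theorem replaceOn_ov_self (C : QuantumCircuit S O) (Γ : List S) (c d : S → ℕ) (j : ℕ) :
    replaceOn Γ (C.ov Γ c j) d = replaceOn Γ c d := by
  funext s
  by_cases h1 : s ∈ Γ
  · rw [replaceOn_of_mem h1, replaceOn_of_mem h1]
  · rw [replaceOn_of_notMem h1, ov_of_notMem _ h1, replaceOn_of_notMem h1]

theorem replaceOn_comm (Γ Δ : List S) (c d : S → ℕ) :
    replaceOn Γ (replaceOn Δ c d) d = replaceOn Δ (replaceOn Γ c d) d := by
  funext s
  by_cases h1 : s ∈ Γ <;> by_cases h2 : s ∈ Δ <;> simp [replaceOn, h1, h2]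

/-! ### Functions on assignments and the subspaces they satisfy -/

/-- The vector of the space of `Γ` that is the restriction of `f` to the values that agree
with `c` outside `Γ`. -/
noncomputable def vec (C : QuantumCircuit S O) (f : (S → ℕ) → ℂ) (Γ : List S) (c : S → ℕ) :
    Hilb (C.dimOf Γ) :=
  WithLp.toLp 2 fun k => f (C.ov Γ c k)

theorem vec_apply (C : QuantumCircuit S O) (f : (S → ℕ) → ℂ) (Γ : List S) (c : S → ℕ)
    (k : Fin (C.dimOf Γ)) : C.vec f Γ c k = f (C.ov Γ c k) := rfl

theorem vec_congr (C : QuantumCircuit S O) (f : (S → ℕ) → ℂ) {Γ : List S} {c c' : S → ℕ}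
    (h : ∀ s, s ∉ Γ → c s = c' s) : C.vec f Γ c = C.vec f Γ c' := by
  ext k
  rw [vec_apply, vec_apply, C.ov_congr _ h]

/-- All restrictions of `f` to the nodes of `Γ` lie in `p`: the function `f` belongs to `p ⊗ ⊤`,
where `⊤` stands for all the other nodes. -/
def Holds (C : QuantumCircuit S O) (Γ : List S) (p : Subsp (C.dimOf Γ)) (f : (S → ℕ) → ℂ) :
    Prop :=
  ∀ c, C.Valid c → C.vec f Γ c ∈ p

theorem holds_of_dimOf_eq_zero (C : QuantumCircuit S O) {Γ : List S} (h : C.dimOf Γ = 0)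
    (p : Subsp (C.dimOf Γ)) (f : (S → ℕ) → ℂ) : C.Holds Γ p f := fun c _ => by
  have : C.vec f Γ c = 0 := by
    ext k
    exact (Nat.not_lt_zero _ (lt_of_lt_of_eq k.2 h)).elim
  rw [this]
  exact p.zero_mem

theorem Holds.mono {C : QuantumCircuit S O} {Γ : List S} {p q : Subsp (C.dimOf Γ)}
    {f : (S → ℕ) → ℂ} (h : C.Holds Γ p f) (hpq : p ≤ q) : C.Holds Γ q f :=
  fun c hc => hpq (h c hc)

/-- The last factor varies fastest in `enc`, exactly as in `finProdFinEquiv`, so a column fixes the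
values on `Δ`. -/
theorem col_vec (C : QuantumCircuit S O) {Γ Δ : List S} (h : (Γ ++ Δ).Nodup)
    (f : (S → ℕ) → ℂ) (c : S → ℕ) (j : Fin (C.dimOf Δ)) :
    col (castLin (C.dimOf_append Γ Δ) (C.vec f (Γ ++ Δ) c)) j = C.vec f Γ (C.ov Δ c j) := by
  ext i
  rw [vec_apply, ← C.ov_append h c i.2 j.2]
  rfl

theorem Holds.tensorTop {C : QuantumCircuit S O} {Γ Δ : List S} (hΓΔ : (Γ ++ Δ).Nodup)
    {p : Subsp (C.dimOf Γ)} {f : (S → ℕ) → ℂ} (h : C.Holds Γ p f) :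
    C.Holds (Γ ++ Δ) (C.tensorTop Γ Δ p) f := fun c hc => by
  rw [QuantumCircuit.tensorTop, mem_transport, mem_tensor_top]
  intro j
  rw [col_vec _ hΓΔ]
  exact h _ (hc.ov Δ j.2)

/-- If `Δ` had dimension zero, the space of `Γ :: Δ` would be trivial and the assumption empty.
Otherwise the values of `c` on `Δ` are in range and select a column. -/
theorem Holds.of_tensorTop {C : QuantumCircuit S O} {Γ Δ : List S} (hΓΔ : (Γ ++ Δ).Nodup)
    {p : Subsp (C.dimOf Γ)} {f : (S → ℕ) → ℂ} (h0 : C.dimOf Δ ≠ 0)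
    (h : C.Holds (Γ ++ Δ) (C.tensorTop Γ Δ p) f) : C.Holds Γ p f := fun c hc => by
  have h1 := h c hc
  rw [QuantumCircuit.tensorTop, mem_transport, mem_tensor_top] at h1
  have h2 := h1 ⟨C.enc Δ c, C.enc_lt (hc.validOn h0)⟩
  rwa [col_vec _ hΓΔ, C.ov_enc (hc.validOn h0) fun _ _ => rfl] at h2

theorem vec_swap (C : QuantumCircuit S O) {Γ Δ Ξ : List S} (h : (Γ ++ Δ ++ Ξ).Nodup)
    (f : (S → ℕ) → ℂ) (c : S → ℕ) :
    castLin (C.dimOf_append₃ Δ Γ Ξ) (C.vec f (Δ ++ Γ ++ Ξ) c) =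
      swapMap (C.dimOf Γ) (C.dimOf Δ) (C.dimOf Ξ)
        (castLin (C.dimOf_append₃ Γ Δ Ξ) (C.vec f (Γ ++ Δ ++ Ξ) c)) := by
  have hd := List.disjoint_of_nodup_append (List.nodup_append.mp h).1
  have h' : (Δ ++ Γ ++ Ξ).Nodup := ((List.perm_append_comm.append_right Ξ).nodup_iff).mp h
  ext k
  obtain ⟨⟨u, l⟩, rfl⟩ := finProdFinEquiv.surjective k
  obtain ⟨⟨j, i⟩, rfl⟩ := finProdFinEquiv.surjective u
  have hs : (swapIndex (C.dimOf Γ) (C.dimOf Δ) (C.dimOf Ξ)).symm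
      (finProdFinEquiv (finProdFinEquiv (j, i), l)) =
      finProdFinEquiv (finProdFinEquiv (i, j), l) := by
    rw [Equiv.symm_apply_eq]
    simp only [swapIndex, Equiv.trans_apply, Equiv.symm_apply_apply, Equiv.prodCongr_apply,
      Prod.map_apply, Equiv.prodComm_apply, Prod.swap_prod_mk, Equiv.refl_apply]
  have key : ∀ {A B : List S} (_ : (A ++ B ++ Ξ).Nodup) (a : Fin (C.dimOf A))
      (b : Fin (C.dimOf B)),
      castLin (C.dimOf_append₃ A B Ξ) (C.vec f (A ++ B ++ Ξ) c)
        (finProdFinEquiv (finProdFinEquiv (a, b), l)) =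
      f (C.ov A (C.ov B (C.ov Ξ c l) b) a) := by
    intro A B hn a b
    rw [← C.ov_append (List.nodup_append.mp hn).1 _ a.2 b.2]
    have hlt : (b : ℕ) + C.dimOf B * a < C.dimOf (A ++ B) := by
      rw [dimOf_append]
      exact (finProdFinEquiv (a, b)).2
    rw [← C.ov_append hn _ hlt l.2]
    rfl
  show _ = castLin (C.dimOf_append₃ Γ Δ Ξ) (C.vec f (Γ ++ Δ ++ Ξ) c)
    ((swapIndex (C.dimOf Γ) (C.dimOf Δ) (C.dimOf Ξ)).symm _)
  rw [hs, key h, key h', C.ov_comm hd]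

theorem holds_swapSubsp (C : QuantumCircuit S O) {Γ Δ Ξ : List S} (h : (Γ ++ Δ ++ Ξ).Nodup)
    {p : Subsp (C.dimOf (Γ ++ Δ ++ Ξ))} {f : (S → ℕ) → ℂ} :
    C.Holds (Δ ++ Γ ++ Ξ) (C.swapSubsp Γ Δ Ξ p) f ↔ C.Holds (Γ ++ Δ ++ Ξ) p f := by
  refine forall₂_congr fun c _ => ?_
  rw [swapSubsp, mem_transport, vec_swap _ h, Submodule.mem_map]
  constructor
  · rintro ⟨w, hw, hw'⟩
    have := (swapMap _ _ _).injective hw'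
    rw [this, mem_transport, castLin_castLin] at hw
    exact hw
  · intro hp
    refine ⟨_, ?_, rfl⟩
    rwa [mem_transport, castLin_castLin]

/-! ### Operators acting on functions -/

/-- The image of `p` under `M ⊗ Id`, as a subspace of the space of `Γ' :: Δ`. -/
noncomputable def applyLin (C : QuantumCircuit S O) {Γ Γ' : List S}
    (M : Hilb (C.dimOf Γ) →ₗ[ℂ] Hilb (C.dimOf Γ')) (Δ : List S)
    (p : Subsp (C.dimOf (Γ ++ Δ))) : Subsp (C.dimOf (Γ' ++ Δ)) :=
  transport (C.dimOf_append Γ' Δ).symm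
    ((transport (C.dimOf_append Γ Δ) p).map (tensorId M (C.dimOf Δ)))

theorem mem_applyLin (C : QuantumCircuit S O) {Γ Γ' : List S}
    {M : Hilb (C.dimOf Γ) →ₗ[ℂ] Hilb (C.dimOf Γ')} {Δ : List S}
    {p : Subsp (C.dimOf (Γ ++ Δ))} {z : Hilb (C.dimOf (Γ' ++ Δ))} :
    z ∈ C.applyLin M Δ p ↔ ∃ w ∈ p, ∀ j, col (castLin (C.dimOf_append Γ' Δ) z) j =
      M (col (castLin (C.dimOf_append Γ Δ) w) j) := by
  rw [applyLin, mem_transport, Submodule.mem_map]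
  constructor
  · rintro ⟨w, hw, hwz⟩
    refine ⟨castLin (C.dimOf_append Γ Δ).symm w, mem_transport _ |>.mp hw, fun j => ?_⟩
    rw [← hwz, col_tensorId]
    rfl
  · rintro ⟨w, hw, h⟩
    refine ⟨castLin (C.dimOf_append Γ Δ) w, ?_, hilb_ext_col fun j => ?_⟩
    · rwa [mem_transport, castLin_castLin]
    · rw [col_tensorId, h]

/-- The action of `M` on functions: the nodes of `Γ` are used up, those of `Γ'` are created. -/
noncomputable def evolve (C : QuantumCircuit S O) {Γ Γ' : List S}
    (M : Hilb (C.dimOf Γ) →ₗ[ℂ] Hilb (C.dimOf Γ')) (f : (S → ℕ) → ℂ) (e : S → ℕ) : ℂ :=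
  ∑ l, coef M (C.enc Γ' e) l * f (C.ov Γ (replaceOn Γ' e 0) l)

/-- In `evolve`, the argument of `f` is frozen at 0 on the created nodes, so that the input of `M`
is one vector, the same for all values on `Γ'`. -/
theorem vec_evolve (C : QuantumCircuit S O) {Γ Γ' : List S} (hΓ' : Γ'.Nodup)
    (M : Hilb (C.dimOf Γ) →ₗ[ℂ] Hilb (C.dimOf Γ')) (f : (S → ℕ) → ℂ) (e : S → ℕ) :
    C.vec (C.evolve M f) Γ' e = M (C.vec f Γ (replaceOn Γ' e 0)) := by
  ext k
  rw [apply_eq_sum_coef, vec_apply, evolve, C.enc_ov hΓ' _ k.2, replaceOn_ov_self]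
  rfl

theorem Holds.evolve {C : QuantumCircuit S O} {Γ Γ' Δ : List S} (hΓ : (Γ ++ Δ).Nodup)
    (hΓ' : (Γ' ++ Δ).Nodup) (M : Hilb (C.dimOf Γ) →ₗ[ℂ] Hilb (C.dimOf Γ'))
    {p : Subsp (C.dimOf (Γ ++ Δ))} {f : (S → ℕ) → ℂ} (h : C.Holds (Γ ++ Δ) p f) :
    C.Holds (Γ' ++ Δ) (C.applyLin M Δ p) (C.evolve M f) := fun c hc => by
  rw [mem_applyLin]
  refine ⟨_, h (QuantumCircuit.replaceOn Γ' c 0) (hc.replaceOn C.valid_zero Γ'), fun j => ?_⟩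
  rw [col_vec _ hΓ, col_vec _ hΓ', vec_evolve _ (List.nodup_append.mp hΓ').1,
    replaceOn_ov _ (List.disjoint_of_nodup_append hΓ')]

/-- On untouched nodes, the restrictions of the evolved function are linear combinations of
restrictions of `f`; no isometry is needed. -/
theorem Holds.evolve_of_disjoint {C : QuantumCircuit S O} {Γ Γ' B : List S}
    (hΓ : Γ.Disjoint B) (hΓ' : Γ'.Disjoint B)
    (M : Hilb (C.dimOf Γ) →ₗ[ℂ] Hilb (C.dimOf Γ')) {p : Subsp (C.dimOf B)}
    {f : (S → ℕ) → ℂ} (h : C.Holds B p f) : C.Holds B p (C.evolve M f) := fun c hc => by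
  have : C.vec (C.evolve M f) B c = ∑ l, coef M (C.enc Γ' c) l •
      C.vec f B (C.ov Γ (QuantumCircuit.replaceOn Γ' c 0) l) := by
    ext k
    rw [WithLp.ofLp_sum, Finset.sum_apply, vec_apply, QuantumCircuit.evolve,
      C.enc_ov_of_disjoint hΓ', replaceOn_ov _ hΓ']
    refine Finset.sum_congr rfl fun l _ => ?_
    rw [C.ov_comm hΓ]
    rfl
  rw [this]
  exact Submodule.sum_mem _ fun l _ => p.smul_mem _
    (h _ ((hc.replaceOn C.valid_zero Γ').ov Γ l.2))

theorem evolve_comm (C : QuantumCircuit S O) {Γ₁ Γ₁' Γ₂ Γ₂' : List S}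
    (h₁ : Γ₁.Disjoint Γ₂) (h₂ : Γ₁'.Disjoint Γ₂) (h₃ : Γ₁.Disjoint Γ₂')
    (h₄ : Γ₁'.Disjoint Γ₂')
    (M₁ : Hilb (C.dimOf Γ₁) →ₗ[ℂ] Hilb (C.dimOf Γ₁'))
    (M₂ : Hilb (C.dimOf Γ₂) →ₗ[ℂ] Hilb (C.dimOf Γ₂')) (f : (S → ℕ) → ℂ) :
    C.evolve M₁ (C.evolve M₂ f) = C.evolve M₂ (C.evolve M₁ f) := by
  have henc : ∀ {A B : List S} (_ : A.Disjoint B) (e : S → ℕ),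
      C.enc A (replaceOn B e 0) = C.enc A e := fun h e =>
    C.enc_congr fun s hs => replaceOn_of_notMem (h hs)
  funext e
  simp only [evolve, Finset.mul_sum]
  rw [Finset.sum_comm]
  refine Finset.sum_congr rfl fun l₂ _ => Finset.sum_congr rfl fun l₁ _ => ?_
  rw [C.enc_ov_of_disjoint h₃.symm, henc h₄.symm, C.enc_ov_of_disjoint h₂, henc h₄,
    replaceOn_ov _ h₃.symm, replaceOn_ov _ h₂, replaceOn_comm, C.ov_comm h₁]
  ring

/-- A function that satisfies `(M ⊗ Id)(p)` is locally the result of applying `M` to a function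
that satisfies `p`. -/
theorem exists_evolve_eq (C : QuantumCircuit S O) {Γ Γ' X : List S} (hΓ : (Γ ++ X).Nodup)
    (hΓ' : (Γ' ++ X).Nodup) (M : Hilb (C.dimOf Γ) →ₗ[ℂ] Hilb (C.dimOf Γ'))
    {p : Subsp (C.dimOf (Γ ++ X))} {f : (S → ℕ) → ℂ}
    (hf : C.Holds (Γ' ++ X) (C.applyLin M X p) f) (c : S → ℕ) :
    ∃ h, C.Holds (Γ ++ X) p h ∧ ∀ e, C.Valid e → (∀ s ∈ Γ, e s = c s) →
      C.ValidOn (Γ' ++ X) e → C.evolve M h e = f e := by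
  classical
  -- The preimage is chosen as a function of the vector `u` alone, with the default 0 outside the
  -- image.
  have hN : ∀ u : Hilb (C.dimOf (Γ' ++ X)), ∃ w ∈ p, u ∈ C.applyLin M X p →
      ∀ j, col (castLin (C.dimOf_append Γ' X) u) j =
        M (col (castLin (C.dimOf_append Γ X) w) j) := by
    intro u
    by_cases hu : u ∈ C.applyLin M X p
    · obtain ⟨w, hw, h⟩ := C.mem_applyLin.mp hu
      exact ⟨w, hw, fun _ => h⟩
    · exact ⟨0, p.zero_mem, fun h => (hu h).elim⟩
  choose N hNp hN using hN
  -- Fixing the values on `Γ` to those of `c` makes the argument of `N` constant while `Γ ++ X`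
  -- varies, so that the restriction of `h` is a single chosen preimage. This is why the equality is
  -- only local: `evolve M h` ignores the values on `Γ`, but `f` may depend on them.
  set h : (S → ℕ) → ℂ := fun e => if he : C.enc (Γ ++ X) e < C.dimOf (Γ ++ X) then
    N (C.vec f (Γ' ++ X) (replaceOn Γ e c)) ⟨_, he⟩ else 0 with hdef
  have hvec : ∀ e, C.vec h (Γ ++ X) e = N (C.vec f (Γ' ++ X) (replaceOn Γ e c)) := by
    intro e
    ext k
    rw [vec_apply, hdef]
    have hk := C.enc_ov hΓ e k.2
    have hv : C.vec f (Γ' ++ X) (replaceOn Γ (C.ov (Γ ++ X) e k) c) =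
        C.vec f (Γ' ++ X) (replaceOn Γ e c) := by
      refine C.vec_congr f fun s hs => ?_
      by_cases h1 : s ∈ Γ
      · rw [replaceOn_of_mem h1, replaceOn_of_mem h1]
      · rw [replaceOn_of_notMem h1, replaceOn_of_notMem h1, ov_of_notMem]
        simp only [List.mem_append, not_or] at hs ⊢
        exact ⟨h1, hs.2⟩
    simp only [hk, hv, k.2, dif_pos]
  refine ⟨h, fun e _ => by rw [hvec]; exact hNp _, fun e he hec hval => ?_⟩
  have hX : C.ValidOn X e := fun s hs => hval s (List.mem_append_right _ hs)
  have hG : C.ValidOn Γ' e := fun s hs => hval s (List.mem_append_left _ hs)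
  have hd := List.disjoint_of_nodup_append hΓ'
  have h0 : C.ov X (replaceOn Γ' e 0) (C.enc X e) = replaceOn Γ' e 0 := by
    have : C.enc X e = C.enc X (replaceOn Γ' e 0) :=
      C.enc_congr fun s hs => (replaceOn_of_notMem (hd.symm hs)).symm
    rw [this]
    refine C.ov_enc (fun s hs => ?_) fun _ _ => rfl
    rw [replaceOn_of_notMem (hd.symm hs)]
    exact hX s hs
  have h1 : C.vec f (Γ' ++ X) (replaceOn Γ (replaceOn Γ' e 0) c) = C.vec f (Γ' ++ X) e := by
    refine C.vec_congr f fun s hs => ?_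
    by_cases h1 : s ∈ Γ
    · rw [replaceOn_of_mem h1, hec s h1]
    · rw [replaceOn_of_notMem h1, replaceOn_of_notMem fun h2 => hs (List.mem_append_left _ h2)]
  have h2 := col_vec C hΓ h (replaceOn Γ' e 0) ⟨C.enc X e, C.enc_lt hX⟩
  simp only [h0] at h2
  have h3 := vec_evolve C (List.nodup_append.mp hΓ').1 M h e
  rw [← h2, hvec, h1, ← hN _ (hf e he), col_vec _ hΓ', C.ov_enc hX fun _ _ => rfl] at h3
  have h4 := congrArg (fun v : Hilb (C.dimOf Γ') => v ⟨C.enc Γ' e, C.enc_lt hG⟩) h3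
  simp only [vec_apply] at h4
  rwa [C.ov_enc hG fun _ _ => rfl] at h4

/-- The function with restrictions `v` to the nodes of `Γ` that does not depend on the others. -/
noncomputable def lift (C : QuantumCircuit S O) {Γ : List S} (v : Hilb (C.dimOf Γ))
    (e : S → ℕ) : ℂ :=
  if he : C.enc Γ e < C.dimOf Γ then v ⟨_, he⟩ else 0

theorem vec_lift (C : QuantumCircuit S O) {Γ : List S} (hΓ : Γ.Nodup) (v : Hilb (C.dimOf Γ))
    (c : S → ℕ) : C.vec (C.lift v) Γ c = v := by
  ext k
  rw [vec_apply, lift]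
  simp [C.enc_ov hΓ c k.2]

/-! ### Slices, reordering and known functions -/

theorem exists_perm_append_of_subset {A B : List S} (hA : A.Nodup) (h : A ⊆ B) :
    ∃ R, B.Perm (A ++ R) := by
  classical
  exact ⟨B.diff A, (List.subperm_append_diff_self_of_count_le
    (List.subperm_ext_iff.mp (hA.subperm h))).symm⟩

theorem IsSlice.of_subset {C : QuantumCircuit S O} {Γ B : List S} (hΓ : C.IsSlice Γ)
    (hB : B.Nodup) (h : B ⊆ Γ) : C.IsSlice B :=
  ⟨hB, fun s hs t ht => hΓ.2 s (h hs) t (h ht)⟩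

theorem IsSlice.perm {C : QuantumCircuit S O} {Γ Γ' : List S} (hΓ : C.IsSlice Γ)
    (h : Γ.Perm Γ') : C.IsSlice Γ' :=
  hΓ.of_subset (h.nodup_iff.mp hΓ.1) h.symm.subset

/-- The operator of the o-node `o`. -/
noncomputable def nodeMap (C : QuantumCircuit S O) (o : O) :
    Hilb (C.dimOf (C.inp o)) →ₗ[ℂ] Hilb (C.dimOf (C.out o)) :=
  opMap (C.op o)

theorem IsMeasurementNode.applyLin_eq {C : QuantumCircuit S O} {o : O}
    {h : C.dimOf (C.inp o) = C.dimOf (C.out o)} {q : Subsp (C.dimOf (C.inp o))}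
    (ho : C.IsMeasurementNode o h q) (Δ : List S) (p : Subsp (C.dimOf (C.inp o ++ Δ))) :
    transport (C.dimOf_append_congr h Δ) (sasaki p (C.tensorTop (C.inp o) Δ q)) =
      C.applyLin (C.nodeMap o) Δ p := by
  rw [nodeMap, show C.op o = _ from ho]
  exact transport_sasaki h (C.dimOf_append _ _) (C.dimOf_append _ _) _ p q

theorem IsUnitaryNode.applyLin_eq {C : QuantumCircuit S O} {o : O}
    {U : Hilb (C.dimOf (C.inp o)) ≃ₗᵢ[ℂ] Hilb (C.dimOf (C.out o))}
    (ho : C.IsUnitaryNode o U) (Δ : List S) (p : Subsp (C.dimOf (C.inp o ++ Δ))) :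
    C.applySubsp U Δ p = C.applyLin (C.nodeMap o) Δ p := by
  rw [nodeMap, show C.op o = _ from ho]
  rfl

theorem Verifies.applyLin {C : QuantumCircuit S O} {o : O} {Δ : List S}
    {p : Subsp (C.dimOf (C.inp o ++ Δ))} (hp : C.Verifies (C.inp o ++ Δ) p) :
    C.Verifies (C.out o ++ Δ) (C.applyLin (C.nodeMap o) Δ p) := by
  rcases ho : C.op o with U | ⟨h, q⟩
  · have ho' : C.IsUnitaryNode o U := ho
    rw [← ho'.applyLin_eq]
    exact hp.uni ho'
  · have ho' : C.IsMeasurementNode o h q := ho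
    rw [← ho'.applyLin_eq]
    exact hp.sas ho'

theorem dimOf_out (C : QuantumCircuit S O) (o : O) :
    C.dimOf (C.inp o) = C.dimOf (C.out o) := (C.op o).dim_eq

theorem Verifies.isSlice {C : QuantumCircuit S O} {Γ : List S} {p : Subsp (C.dimOf Γ)}
    (h : C.Verifies Γ p) : C.IsSlice Γ := by
  induction h with
  | top hΓ => exact hΓ
  | ord _ _ ih => exact ih
  | meet _ _ ih _ => exact ih
  | swap _ ih => exact ih.perm (List.perm_append_comm.append_right _)
  | sas _ _ ih => exact C.isSlice_out ih
  | uni _ _ ih => exact C.isSlice_out ih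
  | tens _ h _ => exact h

/-- Whatever is verified at `Γ` is verified, in another order of the nodes, at `Γ'`. -/
def VerifiesAlso (C : QuantumCircuit S O) (Γ Γ' : List S) : Prop :=
  ∀ p, C.Verifies Γ p → ∃ p', C.Verifies Γ' p' ∧ ∀ f, C.Holds Γ' p' f ↔ C.Holds Γ p f

theorem VerifiesAlso.trans {C : QuantumCircuit S O} {Γ₁ Γ₂ Γ₃ : List S}
    (h₁ : C.VerifiesAlso Γ₁ Γ₂) (h₂ : C.VerifiesAlso Γ₂ Γ₃) : C.VerifiesAlso Γ₁ Γ₃ :=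
  fun p hp => by
    obtain ⟨p', hp', h⟩ := h₁ p hp
    obtain ⟨p'', hp'', h'⟩ := h₂ p' hp'
    exact ⟨p'', hp'', fun f => (h' f).trans (h f)⟩

theorem verifiesAlso_swap (C : QuantumCircuit S O) (Γ Δ Ξ : List S) :
    C.VerifiesAlso (Γ ++ Δ ++ Ξ) (Δ ++ Γ ++ Ξ) := fun _ hp =>
  ⟨_, hp.swap, fun _ => C.holds_swapSubsp hp.isSlice.1⟩

theorem verifiesAlso_append_comm (C : QuantumCircuit S O) (Γ Δ : List S) :
    C.VerifiesAlso (Γ ++ Δ) (Δ ++ Γ) := by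
  simpa using C.verifiesAlso_swap Γ Δ []

/-- (Swap) acts only at the front of a list. The prefix `Ξ` absorbs the heads in the induction, and
is moved to the end and back around each transposition. -/
theorem verifiesAlso_of_perm (C : QuantumCircuit S O) {Γ Γ' : List S} (h : Γ.Perm Γ') :
    C.VerifiesAlso Γ Γ' := by
  suffices ∀ Ξ, C.VerifiesAlso (Ξ ++ Γ) (Ξ ++ Γ') from this []
  induction h with
  | nil => exact fun _ p hp => ⟨p, hp, fun _ => Iff.rfl⟩
  | @cons x _ _ _ ih =>
    intro Ξ
    simpa using ih (Ξ ++ [x])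
  | swap x y l =>
    intro Ξ
    have h := C.verifiesAlso_swap [y] [x] (l ++ Ξ)
    exact ((C.verifiesAlso_append_comm Ξ (y :: x :: l)).trans (by simpa using h)).trans
      (C.verifiesAlso_append_comm (x :: y :: l) Ξ)
  | trans _ _ ih₁ ih₂ => exact fun Ξ => (ih₁ Ξ).trans (ih₂ Ξ)

/-- The function `f` belongs to the epistemic state of `C` at `Γ`. -/
def Known (C : QuantumCircuit S O) (Γ : List S) (f : (S → ℕ) → ℂ) : Prop :=
  C.Holds Γ (C.epistemicState Γ) f

theorem verifies_epistemicState (C : QuantumCircuit S O) {Γ : List S} (hΓ : C.IsSlice Γ) :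
    C.Verifies Γ (C.epistemicState Γ) := (C.verifies_iff hΓ _).mpr le_rfl

theorem Known.holds {C : QuantumCircuit S O} {Γ : List S} {f : (S → ℕ) → ℂ}
    (hf : C.Known Γ f) {p : Subsp (C.dimOf Γ)} (hp : C.Verifies Γ p) : C.Holds Γ p f :=
  Holds.mono hf ((C.verifies_iff hp.isSlice p).mp hp)

theorem Known.perm {C : QuantumCircuit S O} {Γ Γ' : List S} {f : (S → ℕ) → ℂ}
    (hf : C.Known Γ f) (hΓ : C.IsSlice Γ) (h : Γ.Perm Γ') : C.Known Γ' f := by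
  obtain ⟨p, hp, hpf⟩ := C.verifiesAlso_of_perm h.symm _
    (C.verifies_epistemicState (hΓ.perm h))
  exact (hpf f).mp (hf.holds hp)

/-- (Tens) carries the state at `B` up to `Γ`; the nonzero dimension of the remaining nodes lets the
factor `⊤` be cancelled again. -/
theorem Known.of_subset {C : QuantumCircuit S O} {Γ B : List S} {f : (S → ℕ) → ℂ}
    (hf : C.Known Γ f) (hΓ : C.IsSlice Γ) (h0 : C.dimOf Γ ≠ 0) (hB : B.Nodup) (h : B ⊆ Γ) :
    C.Known B f := by
  obtain ⟨R, hR⟩ := exists_perm_append_of_subset hB h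
  have hs := hΓ.perm hR
  rw [C.dimOf_perm hR, dimOf_append] at h0
  exact Holds.of_tensorTop hs.1 (right_ne_zero_of_mul h0) ((hf.perm hΓ hR).holds
    ((C.verifies_epistemicState (hΓ.of_subset hB h)).tens hs))

theorem Known.node {C : QuantumCircuit S O} {o : O} {Δ : List S} {f : (S → ℕ) → ℂ}
    (hf : C.Known (C.out o ++ Δ) f) (h : C.IsSlice (C.inp o ++ Δ)) :
    C.Holds (C.out o ++ Δ)
      (C.applyLin (C.nodeMap o) Δ (C.epistemicState (C.inp o ++ Δ))) f :=
  hf.holds (C.verifies_epistemicState h).applyLin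

theorem precedes_out (C : QuantumCircuit S O) {o : O} {s t : S} (hs : s ∈ C.inp o)
    (ht : t ∈ C.out o) : C.Precedes s t :=
  Relation.TransGen.tail (b := .inr o)
    (Relation.TransGen.single (show Arrow C.inp C.out (.inl s) (.inr o) from hs))
    (show Arrow C.inp C.out (.inr o) (.inl t) from ht)

theorem out_disjoint (C : QuantumCircuit S O) {o o' : O} (h : o' ≠ o) :
    (C.out o').Disjoint (C.out o) := fun s hs hs' => h (C.out_unique s o' o hs hs')

theorem inp_disjoint (C : QuantumCircuit S O) {o o' : O} (h : o' ≠ o) :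
    (C.inp o').Disjoint (C.inp o) := fun s hs hs' => h (C.inp_unique s o' o hs hs')

theorem Holds.inf {C : QuantumCircuit S O} {Γ : List S} {p q : Subsp (C.dimOf Γ)}
    {f : (S → ℕ) → ℂ} (hp : C.Holds Γ p f) (hq : C.Holds Γ q f) : C.Holds Γ (p ⊓ q) f :=
  fun c hc => ⟨hp c hc, hq c hc⟩

/-! ### Soundness of derivations after an o-node -/

/-- Induction on a derivation, for the property of a slice and of the functions that
belong to the verified subspace. The two rules for o-nodes are joined. -/
theorem Verifies.holds_induction {C : QuantumCircuit S O}
    {P : List S → ((S → ℕ) → ℂ) → Prop}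
    (hperm : ∀ {Γ Γ' f}, Γ.Perm Γ' → P Γ f → P Γ' f)
    (node : ∀ {o Δ p}, C.Verifies (C.inp o ++ Δ) p →
      (∀ f, P (C.inp o ++ Δ) f → C.Holds (C.inp o ++ Δ) p f) →
      ∀ f, P (C.out o ++ Δ) f → C.Holds (C.out o ++ Δ) (C.applyLin (C.nodeMap o) Δ p) f)
    (tens : ∀ {Γ Δ p}, C.Verifies Γ p → C.IsSlice (Γ ++ Δ) → C.dimOf (Γ ++ Δ) ≠ 0 →
      (∀ f, P Γ f → C.Holds Γ p f) → ∀ f, P (Γ ++ Δ) f → C.Holds Γ p f)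
    {Γ : List S} {p : Subsp (C.dimOf Γ)} (h : C.Verifies Γ p) :
    ∀ f, P Γ f → C.Holds Γ p f := by
  induction h with
  | top _ => exact fun _ _ _ _ => trivial
  | ord _ hpq ih => exact fun f hf => (ih f hf).mono hpq
  | meet _ _ ih₁ ih₂ => exact fun f hf => (ih₁ f hf).inf (ih₂ f hf)
  | swap hp ih =>
    exact fun f hf => (C.holds_swapSubsp hp.isSlice.1).mpr
      (ih f (hperm (List.perm_append_comm.append_right _) hf))
  | sas hp ho ih =>
    rw [ho.applyLin_eq]
    exact node hp ih
  | uni hp ho ih =>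
    rw [ho.applyLin_eq]
    exact node hp ih
  | @tens Γ Δ _ hp hΓΔ ih =>
    intro f hf
    by_cases h0 : C.dimOf (Γ ++ Δ) = 0
    · exact C.holds_of_dimOf_eq_zero h0 _ _
    · exact (tens hp hΓΔ h0 ih f hf).tensorTop hΓΔ.1

/-- If `Θ` contains only a part of the outgoing nodes of `o`, then nothing is verified about
this part: all that is verified at `Θ` holds by the epistemic state of the other nodes. -/
theorem Verifies.holds_of_known_rest {C : QuantumCircuit S O} (o : O) {Θ : List S}
    {q : Subsp (C.dimOf Θ)} (h : C.Verifies Θ q) (f : (S → ℕ) → ℂ)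
    (hf : ∃ B : List S, B.Nodup ∧ B ⊆ Θ ∧ (∀ s ∈ Θ, s ∉ B → s ∈ C.out o) ∧
      ¬ C.out o ⊆ Θ ∧ (∀ r ∈ C.out o, ∀ s ∈ Θ, ¬ C.Precedes r s) ∧ C.Known B f) :
    C.Holds Θ q f := by
  revert f
  refine h.holds_induction (P := fun Θ f => ∃ B : List S, B.Nodup ∧ B ⊆ Θ ∧
    (∀ s ∈ Θ, s ∉ B → s ∈ C.out o) ∧ ¬ C.out o ⊆ Θ ∧
      (∀ r ∈ C.out o, ∀ s ∈ Θ, ¬ C.Precedes r s) ∧ C.Known B f) ?_ ?_ ?_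
  · rintro Γ Γ' f hp ⟨B, hB, hBΓ, hrest, hout, hprec, hf⟩
    exact ⟨B, hB, fun s hs => hp.subset (hBΓ hs), fun s hs => hrest s (hp.symm.subset hs),
      fun h => hout fun s hs => hp.symm.subset (h hs),
      fun r hr s hs => hprec r hr s (hp.symm.subset hs), hf⟩
  · rintro o' Δ p hp ih f ⟨B, hB, hBΘ, hrest, hout, hprec, hf⟩ c hc
    have hin := hp.isSlice
    have hout' := C.isSlice_out hin
    have hne : o' ≠ o := by
      rintro rfl
      exact hout fun s hs => List.mem_append_left _ hs
    -- The outputs of `o'` are disjoint from those of `o`, so they all lie in the known part `B`,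
    -- and `f` can be pulled back through `o'`.
    have hsub : C.out o' ⊆ B := fun s hs => by
      by_contra hsB
      exact C.out_disjoint hne hs (hrest s (List.mem_append_left _ hs) hsB)
    obtain ⟨R, hR⟩ := exists_perm_append_of_subset (C.out_nodup o') hsub
    have hRnd := hR.nodup_iff.mp hB
    have hRΔ : R ⊆ Δ := fun s hs =>
      (List.mem_append.mp (hBΘ (hR.symm.subset (List.mem_append_right _ hs)))).resolve_left
        fun h => List.disjoint_of_nodup_append hRnd h hs
    have hindis := List.disjoint_of_nodup_append hin.1
    have hsub' : C.inp o' ++ R ⊆ C.inp o' ++ Δ := fun s hs => by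
      rw [List.mem_append] at hs ⊢
      exact hs.imp_right fun h => hRΔ h
    have hslice : C.IsSlice (C.inp o' ++ R) := hin.of_subset
      (List.nodup_append'.mpr ⟨C.inp_nodup o', (List.nodup_append.mp hRnd).2.1,
        fun s hs hs' => hindis hs (hRΔ hs')⟩) hsub'
    obtain ⟨g, hg⟩ := List.exists_mem_of_ne_nil _ (C.out_ne_nil o')
    have hgΘ : g ∈ C.out o' ++ Δ := List.mem_append_left _ hg
    obtain ⟨k, hk, hkf⟩ := C.exists_evolve_eq hslice.1 hRnd (C.nodeMap o')
      ((hf.perm (hout'.of_subset hB hBΘ) hR).node hslice) c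
    -- Before `o'`, the known part is `inp o' ++ R`. An output of `o` among the inputs of `o'`, or
    -- preceding one, would precede the output `g` of `o'`, which `hprec` forbids.
    have hk' := ih k ⟨_, hslice.1, hsub', ?_, ?_, ?_, hk⟩
    · have := hk'.evolve hin.1 hout'.1 (C.nodeMap o') c hc
      convert this using 1
      ext i
      rw [vec_apply, vec_apply, hkf _ (hc.ov _ i.2)]
      · intro s hs
        refine ov_of_notMem _ fun h => ?_
        exact hout'.2 s h g hgΘ (C.precedes_out hs hg) |>.elim
      · intro s hs
        exact C.validOn_ov _ _ i.2 s (hBΘ (hR.symm.subset hs))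
    · intro s hs hsR
      rw [List.mem_append, not_or] at hsR
      have hsΔ := (List.mem_append.mp hs).resolve_left hsR.1
      refine hrest s (List.mem_append_right _ hsΔ) fun h => ?_
      refine (List.mem_append.mp (hR.subset h)).elim (fun h => ?_) hsR.2
      exact List.disjoint_of_nodup_append hout'.1 h hsΔ
    · refine fun h => hout fun r hr => List.mem_append_right _ ?_
      exact (List.mem_append.mp (h hr)).resolve_left fun h =>
        hprec r hr g hgΘ (C.precedes_out h hg)
    · intro r hr s hs hrs
      rcases List.mem_append.mp hs with hs | hs
      · exact hprec r hr g hgΘ (Relation.TransGen.trans hrs (C.precedes_out hs hg))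
      · exact hprec r hr s (List.mem_append_right _ hs) hrs
  · classical
    rintro Γ Δ p hp hΓΔ h0 ih f ⟨B, hB, hBΘ, hrest, hout, hprec, hf⟩
    have hB0 : C.dimOf B ≠ 0 := by
      obtain ⟨R, hR⟩ := exists_perm_append_of_subset hB hBΘ
      rw [C.dimOf_perm hR, dimOf_append] at h0
      exact left_ne_zero_of_mul h0
    refine ih f ⟨B.filter (· ∈ Γ), hB.filter _,
      fun s hs => by simpa using (List.mem_filter.mp hs).2,
      fun s hs hsB => hrest s (List.mem_append_left _ hs) fun h =>
        hsB (List.mem_filter.mpr ⟨h, by simpa using hs⟩),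
      fun h => hout fun s hs => List.mem_append_left _ (h hs),
      fun r hr s hs => hprec r hr s (List.mem_append_left _ hs),
      hf.of_subset (hΓΔ.of_subset hB hBΘ) hB0 (hB.filter _) (List.filter_subset_self _)⟩

/-- Every statement verified at a slice with the outgoing nodes of `o` holds after the operation
of `o` is applied to the epistemic state at the slice with its incoming nodes. -/
theorem Verifies.holds_evolve {C : QuantumCircuit S O} (o : O) {Θ : List S}
    {q : Subsp (C.dimOf Θ)} (h : C.Verifies Θ q) {Δ : List S} {f : (S → ℕ) → ℂ}
    (hΘ : Θ.Perm (C.out o ++ Δ)) (hΔ : C.IsSlice (C.inp o ++ Δ))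
    (hf : C.Known (C.inp o ++ Δ) f) : C.Holds Θ q (C.evolve (C.nodeMap o) f) := by
  refine h.holds_induction (P := fun Θ f' => ∃ Δ f, Θ.Perm (C.out o ++ Δ) ∧
    C.IsSlice (C.inp o ++ Δ) ∧ C.Known (C.inp o ++ Δ) f ∧ f' = C.evolve (C.nodeMap o) f)
    ?_ ?_ ?_ _ ⟨Δ, f, hΘ, hΔ, hf, rfl⟩
  · rintro Γ Γ' _ hp ⟨Δ, f, hΘ, hΔ, hf, rfl⟩
    exact ⟨Δ, f, hp.symm.trans hΘ, hΔ, hf, rfl⟩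
  · rintro o' Δ' p hp ih _ ⟨Δ, f, hΘ, hΔ, hf, rfl⟩
    have hin := hp.isSlice
    have hout := C.isSlice_out hin
    by_cases hne : o' = o
    · subst hne
      have hperm := (List.perm_append_left_iff _).mp hΘ
      exact ((hf.perm hΔ (hperm.symm.append_left _)).holds hp).evolve hin.1 hout.1 _
    have hsub : C.out o' ⊆ Δ := fun s hs =>
      (List.mem_append.mp (hΘ.subset (List.mem_append_left _ hs))).resolve_left
        (C.out_disjoint hne hs)
    obtain ⟨R, hR⟩ := exists_perm_append_of_subset (C.out_nodup o') hsub
    have hΔ' : Δ'.Perm (C.out o ++ R) := by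
      rw [← List.perm_append_left_iff (C.out o')]
      exact (hΘ.trans (hR.append_left _)).trans (List.perm_append_comm_assoc _ _ _)
    have hs₁ : C.IsSlice (C.out o' ++ (C.inp o ++ R)) :=
      (hΔ.perm (hR.append_left _)).perm (List.perm_append_comm_assoc _ _ _)
    have hs₂ : C.IsSlice (C.out o ++ (C.inp o' ++ R)) :=
      (hin.perm (hΔ'.append_left _)).perm (List.perm_append_comm_assoc _ _ _)
    obtain ⟨g, hg⟩ := List.exists_mem_of_ne_nil _ (C.out_ne_nil o)
    obtain ⟨g', hg'⟩ := List.exists_mem_of_ne_nil _ (C.out_ne_nil o')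
    have hd₁ : (C.inp o').Disjoint (C.inp o) := C.inp_disjoint hne
    have hd₂ : (C.out o').Disjoint (C.inp o ++ R) := List.disjoint_of_nodup_append hs₁.1
    have hd₃ : (C.out o).Disjoint (C.inp o' ++ R) := List.disjoint_of_nodup_append hs₂.1
    have hn₂ := (List.nodup_append'.mp (List.nodup_append'.mp hs₂.1).2.1)
    -- A path from an input of one node to an input of the other would extend to an output of the
    -- latter, contradicting `hs₁` or `hs₂`.
    have hs : C.IsSlice (C.inp o' ++ (C.inp o ++ R)) := by
      refine ⟨List.nodup_append'.mpr ⟨C.inp_nodup o', (List.nodup_append'.mp hs₁.1).2.1, ?_⟩, ?_⟩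
      · intro s h₁ h₂
        rcases List.mem_append.mp h₂ with h₂ | h₂
        · exact hd₁ h₁ h₂
        · exact hn₂.2.2 h₁ h₂
      · intro s hs t ht hst
        simp only [List.mem_append] at hs ht
        have p₁ := fun s hs t ht => hs₁.2 s (List.mem_append.mpr hs) t (List.mem_append.mpr ht)
        have p₂ := fun s hs t ht => hs₂.2 s (List.mem_append.mpr hs) t (List.mem_append.mpr ht)
        simp only [List.mem_append] at p₁ p₂
        rcases hs with hs | hs | hs <;> rcases ht with ht | ht | ht
        · exact p₂ s (by tauto) t (by tauto) hst
        · exact p₂ s (by tauto) g (by tauto)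
            (Relation.TransGen.trans hst (C.precedes_out ht hg))
        · exact p₂ s (by tauto) t (by tauto) hst
        · exact p₁ s (by tauto) g' (by tauto)
            (Relation.TransGen.trans hst (C.precedes_out ht hg'))
        · exact p₁ s (by tauto) t (by tauto) hst
        · exact p₁ s (by tauto) t (by tauto) hst
        · exact p₂ s (by tauto) t (by tauto) hst
        · exact p₁ s (by tauto) t (by tauto) hst
        · exact p₁ s (by tauto) t (by tauto) hst
    intro c hc
    -- Near `c`, `f` is the image under `o'` of some `k` known before both nodes. The induction
    -- hypothesis applies to `k` evolved by `o`; evolving further by `o'` and commuting gives `f`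
    -- evolved by `o`.
    obtain ⟨k, hk, hkf⟩ := C.exists_evolve_eq hs.1 hs₁.1 (C.nodeMap o')
      ((hf.perm hΔ ((hR.append_left _).trans (List.perm_append_comm_assoc _ _ _))).node hs) c
    have hcomm := List.perm_append_comm_assoc (C.inp o') (C.inp o) R
    have hk' := ih _ ⟨C.inp o' ++ R, k,
      (hΔ'.append_left _).trans (List.perm_append_comm_assoc _ _ _), hs.perm hcomm,
      Known.perm hk hs hcomm, rfl⟩
    have := hk'.evolve hin.1 hout.1 (C.nodeMap o') c hc
    rw [C.evolve_comm hd₁ (fun s h h' => hd₂ h (List.mem_append_left _ h'))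
      (fun s h h' => hd₃ h' (List.mem_append_left _ h)) (C.out_disjoint hne)] at this
    convert this using 1
    ext i
    rw [vec_apply, vec_apply, evolve, evolve]
    refine Finset.sum_congr rfl fun l _ => ?_
    rw [hkf _ (((hc.ov _ i.2).replaceOn C.valid_zero _).ov _ l.2)]
    · intro s hs
      rw [ov_of_notMem _ (hd₁ hs),
        replaceOn_of_notMem fun h => hd₃ h (List.mem_append_left _ hs)]
      exact ov_of_notMem _ fun h =>
        hout.2 s h g' (List.mem_append_left _ hg') (C.precedes_out hs hg')
    · intro s hs
      by_cases h₁ : s ∈ C.inp o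
      · exact C.validOn_ov _ _ l.2 s h₁
      · rw [ov_of_notMem _ h₁, replaceOn_of_notMem]
        · refine C.validOn_ov _ _ i.2 s ?_
          simp only [List.mem_append] at hs ⊢
          have := fun h : s ∈ R => hΔ'.symm.subset (List.mem_append_right (C.out o) h)
          tauto
        · intro h
          rcases List.mem_append.mp hs with hs | hs
          · exact C.out_disjoint hne hs h
          · exact hd₃ h (List.mem_append_right _ ((List.mem_append.mp hs).resolve_left h₁))
  · classical
    rintro Γ Ξ p hp hΓΞ h0 ih _ ⟨Δ, f, hΘ, hΔ, hf, rfl⟩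
    have hout := C.isSlice_out hΔ
    have hΔ0 : C.dimOf (C.inp o ++ Δ) ≠ 0 := by
      rwa [dimOf_append, dimOf_out, ← dimOf_append, ← C.dimOf_perm hΘ]
    by_cases hsub : C.out o ⊆ Γ
    · obtain ⟨R, hR⟩ := exists_perm_append_of_subset (C.out_nodup o) hsub
      have hΔR : Δ.Perm (R ++ Ξ) := by
        rw [← List.perm_append_left_iff (C.out o), ← List.append_assoc]
        exact hΘ.symm.trans (hR.append_right _)
      have hs := hΔ.perm (hΔR.append_left _)
      rw [← List.append_assoc] at hs
      have hn := (List.nodup_append.mp hs.1).1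
      have hsubset : C.inp o ++ R ⊆ C.inp o ++ R ++ Ξ := List.subset_append_left _ _
      refine ih _ ⟨R, f, hR, hs.of_subset hn hsubset, hf.of_subset hΔ hΔ0 hn ?_, rfl⟩
      intro s h
      refine (hΔR.append_left _).symm.subset ?_
      rw [← List.append_assoc]
      exact hsubset h
    -- Some output of `o` is missing from `Γ`. The nodes of `Γ` that are not outputs of `o` are
    -- untouched by the evolution, so `f` stays known there, and this decides everything verified at
    -- `Γ`.
    · have hΓn := (List.nodup_append.mp hΓΞ.1).1
      have hΓ : ∀ s ∈ Γ, s ∈ C.out o ++ Δ := fun s hs =>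
        hΘ.subset (List.mem_append_left _ hs)
      have hBΔ : Γ.filter (· ∉ C.out o) ⊆ Δ := fun s hs => by
        obtain ⟨h₁, h₂⟩ := List.mem_filter.mp hs
        exact (List.mem_append.mp (hΓ s h₁)).resolve_left (by simpa using h₂)
      refine hp.holds_of_known_rest o _ ⟨Γ.filter (· ∉ C.out o), hΓn.filter _,
        List.filter_subset_self _, ?_, hsub, ?_, ?_⟩
      · intro s hs hsB
        by_contra h
        exact hsB (List.mem_filter.mpr ⟨hs, by simpa using h⟩)
      · exact fun r hr s hs => hout.2 r (List.mem_append_left _ hr) s (hΓ s hs)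
      · refine Holds.evolve_of_disjoint ?_ ?_ _ (hf.of_subset hΔ hΔ0 (hΓn.filter _)
          fun s hs => List.mem_append_right _ (hBΔ hs))
        · exact fun s h h' => List.disjoint_of_nodup_append hΔ.1 h (hBΔ h')
        · exact fun s h h' => List.disjoint_of_nodup_append hout.1 h (hBΔ h')

/-- The epistemic state after an o-node is the result of its operation. -/
theorem epistemicState_out (C : QuantumCircuit S O) {o : O} {Δ : List S}
    (h : C.IsSlice (C.inp o ++ Δ)) : C.epistemicState (C.out o ++ Δ) =
      C.applyLin (C.nodeMap o) Δ (C.epistemicState (C.inp o ++ Δ)) := by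
  have hout := C.isSlice_out h
  refine le_antisymm ((C.verifies_iff hout _).mp (C.verifies_epistemicState h).applyLin) ?_
  refine le_sInf fun q hq z hz => ?_
  obtain ⟨w, hw, hwz⟩ := C.mem_applyLin.mp hz
  -- Extended independently of all other nodes, `w` becomes a known function.
  have hlift : C.Known (C.inp o ++ Δ) (C.lift w) := fun c _ => by
    rw [C.vec_lift h.1]
    exact hw
  have := Verifies.holds_evolve o hq (List.Perm.refl _) h hlift 0 C.valid_zero
  convert this
  have hz' : castLin (C.dimOf_append _ _) z = castLin (C.dimOf_append _ _)
      (C.vec (C.evolve (C.nodeMap o) (C.lift w)) (C.out o ++ Δ) 0) := by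
    refine hilb_ext_col fun j => ?_
    rw [hwz, col_vec _ hout.1, vec_evolve _ (C.out_nodup o),
      replaceOn_ov _ (List.disjoint_of_nodup_append hout.1), ← col_vec _ h.1, C.vec_lift h.1]
  rw [← castLin_castLin (C.dimOf_append _ _) z, hz', castLin_castLin]

end QuantumCircuit

theorem mainTheorem3 {S O : Type*} (C : QuantumCircuit S O) (o : O) (Δ : List S)
    (hΓΔ : C.IsSlice (C.inp o ++ Δ))
    (h : C.dimOf (C.inp o) = C.dimOf (C.out o)) (p : Subsp (C.dimOf (C.inp o)))
    (ho : C.IsMeasurementNode o h p) :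
    C.IsSlice (C.out o ++ Δ) ∧
      C.epistemicState (C.out o ++ Δ) =
        transport (C.dimOf_append_congr h Δ)
          (sasaki (C.epistemicState (C.inp o ++ Δ)) (C.tensorTop (C.inp o) Δ p)) := by
  refine ⟨C.isSlice_out hΓΔ, ?_⟩
  rw [ho.applyLin_eq]
  exact C.epistemicState_out hΓΔ
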